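/- Let $F=F_n$ be a free group of finite rank $n$ with basis $X=\{x_1,\dots,x_n\}$. For a subset $S\subseteq F$ and $g\in F$, let $\mathrm{Ord}_S(g)$ be the least integer $k\ge 1$ such that $g^k\in S$ if such a $k$ exists, and $0$ otherwise; the spectrum of $F$ with respect to $S$ is the set $\mathrm{Ord}_S(F)=\{\mathrm{Ord}_S(g) : g\in F\}\subseteq\mathbb{N}$. A subgroup $H\le F$ is called pure if $\{g\in F : \mathrm{Ord}_H(g)\ge 1\}=H$ (equivalently, $\mathrm{Ord}_H(F)\subseteq\{0,1\}$). In all algorithms below, elements of $F$ are given by words in $X^{\pm1}$ and finitely generated subgroups by finite lists of words that represent generators, which are part of the input. (1) There is an algorithm which, given a finitely generated subgroup $H\le F$ and elements $u,w\in F$, outputs $\mathrm{Ord}_{Hu}(w)$. (2) For every finitely generated subgroup $H\le F$ and every $u\in F$ the spectrum $\mathrm{Ord}_{Hu}(F)$ is finite, and there is an algorithm which, given $H$ and $u$, outputs this finite set. (3) Consequently, the following problems are computable for $F$, where $H$ denotes a finitely generated subgroup of $F$: - the order problem $\mathrm{OP}(F)$: given $H$ and $g\in F$, output $\mathrm{Ord}_H(g)$;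 - the torsion problem $\mathrm{TP}(F)$: given $H$ and $g\in F$, decide whether $\mathrm{Ord}_H(g)\ge 1$; - the finite spectrum problem $\mathrm{FSP}(F)$: given $H$, decide whether $\mathrm{Ord}_H(F)$ is finite and, if so, output it; - the spectrum membership problem $\mathrm{SMP}(F)$: given $H$ and $m\in\mathbb{N}$, decide whether $m\in\mathrm{Ord}_H(F)$; - the torsion-group problem $\mathrm{TGP}(F)$: given $H$, decide whether $\mathrm{Ord}_H(g)\ge 1$ for all $g\in F$, that is, whether $0\notin\mathrm{Ord}_H(F)$; - the purity problem $\mathrm{PP}(F)$: given $H$, decide whether $H$ is pure in $F$. -/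

import Mathlib

namespace RelativeOrder

section Orders

/-- The relative order of `g` in the subset `S`: the least `k ≥ 1` with `g ^ k ∈ S` if there is
one, and `0` otherwise (the infimum of the empty set of natural numbers is `0`). -/
noncomputable def relOrder {G : Type*} [Group G] (S : Set G) (g : G) : ℕ :=
  sInf {k : ℕ | 1 ≤ k ∧ g ^ k ∈ S}

/-- The spectrum of `G` with respect to the subset `S`: the set of all orders in `S` of elements
of `G`. -/
def ordSpectrum {G : Type*} [Group G] (S : Set G) : Set ℕ :=
  Set.range (relOrder S)

/-- The right coset `H u = {h * u | h ∈ H}`. -/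
def rightCoset {G : Type*} [Group G] (H : Subgroup G) (u : G) : Set G :=
  (fun h : G => h * u) '' (H : Set G)

/-- `g` is periodic with respect to `H` (a nontrivial root of `H`). -/
def IsPeriodicElt {G : Type*} [Group G] (H : Subgroup G) (g : G) : Prop :=
  1 ≤ relOrder (H : Set G) g

/-- `G` is periodic with respect to `H`: every element of `G` is. -/
def IsPeriodicGroup {G : Type*} [Group G] (H : Subgroup G) : Prop :=
  ∀ g : G, IsPeriodicElt H g

/-- `H` is pure in `G`: the set of its nontrivial roots is `H` itself. -/
def IsPure {G : Type*} [Group G] (H : Subgroup G) : Prop :=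
  {g : G | IsPeriodicElt H g} = (H : Set G)

/-- Sanity check: the order is `k ≥ 1` iff `g ^ k` is the first positive power of `g` in `S`. -/
theorem relOrder_eq_iff {G : Type*} [Group G] (S : Set G) (g : G) (k : ℕ) (hk : 1 ≤ k) :
    relOrder S g = k ↔ g ^ k ∈ S ∧ ∀ i, 1 ≤ i → i < k → g ^ i ∉ S := by
  constructor
  · intro h
    have hne : {k : ℕ | 1 ≤ k ∧ g ^ k ∈ S}.Nonempty := by
      apply Nat.nonempty_of_pos_sInf
      change 0 < relOrder S g
      omega
    have h1 := Nat.sInf_mem hne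
    change 1 ≤ relOrder S g ∧ g ^ (relOrder S g) ∈ S at h1
    rw [h] at h1
    refine ⟨h1.2, fun i hi hik hS => ?_⟩
    have h2 : relOrder S g ≤ i := Nat.sInf_le ⟨hi, hS⟩
    omega
  · rintro ⟨hS, hlt⟩
    have h2 : relOrder S g ≤ k := Nat.sInf_le ⟨hk, hS⟩
    have h1 := Nat.sInf_mem (s := {k : ℕ | 1 ≤ k ∧ g ^ k ∈ S}) ⟨k, hk, hS⟩
    change 1 ≤ relOrder S g ∧ g ^ (relOrder S g) ∈ S at h1
    by_contra hne
    exact hlt _ h1.1 (by omega) h1.2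

/-- Sanity check: the order is `0` iff no positive power of `g` lies in `S`. -/
theorem relOrder_eq_zero_iff {G : Type*} [Group G] (S : Set G) (g : G) :
    relOrder S g = 0 ↔ ∀ i, 1 ≤ i → g ^ i ∉ S := by
  constructor
  · intro h i hi hS
    have h1 := Nat.sInf_mem (s := {k : ℕ | 1 ≤ k ∧ g ^ k ∈ S}) ⟨i, hi, hS⟩
    change 1 ≤ relOrder S g ∧ _ at h1
    omega
  · intro h
    have : {k : ℕ | 1 ≤ k ∧ g ^ k ∈ S} = ∅ := by
      ext k
      simpa using h k
    unfold relOrder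
    rw [this]
    exact Nat.sInf_empty

end Orders

section Problems

/-- Group words over the alphabet `X`: the letter `(a, true)` stands for `a` and `(a, false)` for
its inverse. Words need not be reduced. -/
abbrev Word (X : Type*) : Type _ := List (X × Bool)

/-- The element of `G` that a word represents, when the letter `a` stands for `x a`. -/
def wordVal {X G : Type*} [Group G] (x : X → G) (w : Word X) : G :=
  FreeGroup.lift x (FreeGroup.mk w)

/-- The finitely generated subgroup of `G` given by a finite list of words. -/
def wordSubgroup {X G : Type*} [Group G] (x : X → G) (L : List (Word X)) : Subgroup G :=
  Subgroup.closure {g : G | ∃ w ∈ L, wordVal x w = g}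

/-- `l` is the complete output of the finite set `A`: its elements, once each, in increasing
order. -/
def ListsSet (l : List ℕ) (A : Set ℕ) : Prop :=
  l.Pairwise (· < ·) ∧ ∀ k : ℕ, k ∈ l ↔ k ∈ A

/- The algorithmic problems for a group `G` with a marking `x : X → G` by a (coded) alphabet.
Algorithms are total computable functions; elements are input as words, and finitely generated
subgroups as finite lists of words. -/

/-- There is an algorithm which computes the order of an element in a coset `H u`. -/
def CosetOrderComputable {X G : Type*} [Primcodable X] [Group G] (x : X → G) : Prop :=
  ∃ f : List (Word X) × Word X × Word X → ℕ, Computable f ∧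
    ∀ (L : List (Word X)) (u w : Word X),
      f (L, u, w) = relOrder (rightCoset (wordSubgroup x L) (wordVal x u)) (wordVal x w)

/-- There is an algorithm which outputs the (always finite) spectrum of `G` with respect to a
coset `H u`. -/
def CosetSpectrumComputable {X G : Type*} [Primcodable X] [Group G] (x : X → G) : Prop :=
  ∃ f : List (Word X) × Word X → List ℕ, Computable f ∧
    ∀ (L : List (Word X)) (u : Word X),
      ListsSet (f (L, u)) (ordSpectrum (rightCoset (wordSubgroup x L) (wordVal x u)))

/-- The order problem is computable. -/
def OrderProblem {X G : Type*} [Primcodable X] [Group G] (x : X → G) : Prop :=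
  ∃ f : List (Word X) × Word X → ℕ, Computable f ∧
    ∀ (L : List (Word X)) (w : Word X),
      f (L, w) = relOrder (wordSubgroup x L : Set G) (wordVal x w)

/-- The torsion problem is decidable: is a given element periodic with respect to `H`? -/
def TorsionProblem {X G : Type*} [Primcodable X] [Group G] (x : X → G) : Prop :=
  ComputablePred fun p : List (Word X) × Word X =>
    IsPeriodicElt (wordSubgroup x p.1) (wordVal x p.2)

/-- The finite spectrum problem is computable: decide whether the spectrum with respect to `H` is
finite and, if so, output it. -/
def FiniteSpectrumProblem {X G : Type*} [Primcodable X] [Group G] (x : X → G) : Prop :=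
  ∃ f : List (Word X) → Option (List ℕ), Computable f ∧
    ∀ L : List (Word X),
      ((ordSpectrum (wordSubgroup x L : Set G)).Finite →
        ∃ l : List ℕ, f L = some l ∧ ListsSet l (ordSpectrum (wordSubgroup x L : Set G))) ∧
      (¬ (ordSpectrum (wordSubgroup x L : Set G)).Finite → f L = none)

/-- The spectrum membership problem is decidable: does `G` have elements of order `m` in `H`? -/
def SpectrumMembershipProblem {X G : Type*} [Primcodable X] [Group G] (x : X → G) : Prop :=
  ComputablePred fun p : List (Word X) × ℕ =>
    p.2 ∈ ordSpectrum (wordSubgroup x p.1 : Set G)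

/-- The torsion-group problem is decidable: is `G` periodic with respect to `H`? -/
def TorsionGroupProblem {X G : Type*} [Primcodable X] [Group G] (x : X → G) : Prop :=
  ComputablePred fun L : List (Word X) => IsPeriodicGroup (wordSubgroup x L)

/-- The purity problem is decidable: is `H` pure in `G`? -/
def PurityProblem {X G : Type*} [Primcodable X] [Group G] (x : X → G) : Prop :=
  ComputablePred fun L : List (Word X) => IsPure (wordSubgroup x L)

end Problems

end RelativeOrder

/-! `F` acts on the left cosets `F ⧸ H`, and `g ∈ Hu` means that `g` carries the point `u⁻¹H` to
`H`. Words are read from right to left as paths in this Schreier graph. Let `Γ` be the finite set of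
points on the paths from `H` labelled by the generators of `H` and by `u⁻¹`. Deleting backtracks
keeps a path inside `Γ`, so every reduced path between points of `Γ` stays in `Γ`
(`isPathConvex_pathPoints`).

Write `g = v c v⁻¹` so that `v c^k v⁻¹` is reduced for every `k ≥ 1`. If `g^m` is the first positive
power in `Hu`, its path stays in `Γ`, and so do the points between the copies of `c`. A repetition
among them would give a smaller exponent, whence `m ≤ |Γ|` (`relOrder_le_card`). This bounds the
spectrum and the search for a single order.

To find which orders occur, attach to a word its partial action on `Γ`, its end letters and whether
it is reduced. There are finitely many such signatures and they are compatible with concatenation,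
so `v` and `c` may be replaced by short words without changing the order
(`exists_short_relOrder_eq`).

Membership in `H` is decided by Marshall Hall completion: if `w ∉ H`, some permutation action of
bounded degree separates `w` from `H` (`memTest_iff`). All searches are bounded, hence primitive
recursive, and the remaining problems are read off from the orders and the spectrum. -/

namespace RelativeOrder

open FreeGroup

/-! ### Paths in a set of points of an action of the free group. -/

section Paths

variable {α S : Type*} [MulAction (FreeGroup α) S] {Γ : Set S}

/-- Reading the word `w` from right to left as a path that starts at `p`, all the points on the
way lie in `Γ`. -/
def Stays (Γ : Set S) : List (α × Bool) → S → Prop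
  | [], p => p ∈ Γ
  | a :: w, p => Stays Γ w p ∧ mk (a :: w) • p ∈ Γ

theorem mk_append_smul (v w : List (α × Bool)) (p : S) : mk (v ++ w) • p = mk v • mk w • p := by
  rw [← mul_mk, mul_smul]

theorem mk_nil_smul (p : S) : mk ([] : List (α × Bool)) • p = p := by
  rw [← one_eq_mk, one_smul]

theorem Stays.end_mem {w : List (α × Bool)} {p : S} (h : Stays Γ w p) : mk w • p ∈ Γ := by
  cases w with
  | nil => rw [mk_nil_smul]; exact h
  | cons a w => exact h.2

theorem stays_append {v w : List (α × Bool)} {p : S} :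
    Stays Γ (v ++ w) p ↔ Stays Γ w p ∧ Stays Γ v (mk w • p) := by
  induction v with
  | nil => exact ⟨fun h => ⟨h, h.end_mem⟩, fun h => h.1⟩
  | cons a v ih =>
    change Stays Γ (v ++ w) p ∧ mk ((a :: v) ++ w) • p ∈ Γ ↔
      Stays Γ w p ∧ Stays Γ v (mk w • p) ∧ mk (a :: v) • mk w • p ∈ Γ
    rw [ih, mk_append_smul, and_assoc]

/-- A cancelling pair of letters is a step out and straight back, so deleting it only removes
visited points. -/
theorem Stays.red {v w : List (α × Bool)} {p : S} (h : Stays Γ v p) (hr : Red v w) :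
    Stays Γ w p := by
  induction hr with
  | refl => exact h
  | tail _ hs ih =>
    cases hs with
    | @not L₁ L₂ x b =>
      rw [stays_append] at ih ⊢
      have hmk : mk ((x, b) :: (x, !b) :: L₂) = mk L₂ := Quot.sound (Red.Step.cons_not)
      rw [hmk] at ih
      exact ⟨ih.1.1.1, ih.2⟩

theorem Stays.invRev {w : List (α × Bool)} {p : S} (h : Stays Γ w p) :
    Stays Γ (FreeGroup.invRev w) (mk w • p) := by
  induction w with
  | nil => rw [mk_nil_smul]; exact h
  | cons a w ih =>
    have e : FreeGroup.invRev (a :: w) = FreeGroup.invRev w ++ [(a.1, !a.2)] := by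
      simp [FreeGroup.invRev]
    have e2 : mk [(a.1, !a.2)] • mk (a :: w) • p = mk w • p := by
      rw [← mk_append_smul]
      congr 1
      exact Quot.sound (Red.Step.cons_not_rev)
    rw [e, stays_append, e2]
    refine ⟨⟨h.2, ?_⟩, ih h.1⟩
    rw [e2]
    exact h.1.end_mem

theorem stays_of_suffix {w : List (α × Bool)} {p : S} (h : ∀ s, s <:+ w → mk s • p ∈ Γ) :
    Stays Γ w p := by
  induction w with
  | nil =>
    have := h [] (List.suffix_refl _)
    rwa [mk_nil_smul] at this
  | cons a w ih =>
    exact ⟨ih fun s hs => h s (hs.trans (List.suffix_cons a w)), h _ (List.suffix_refl _)⟩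

/-- A set of points is convex if it contains every point on every reduced path between two of its
points. -/
def IsPathConvex (α : Type*) {S : Type*} [MulAction (FreeGroup α) S] (Γ : Set S) : Prop :=
  ∀ (w : List (α × Bool)) (p : S), IsReduced w → p ∈ Γ → mk w • p ∈ Γ → Stays Γ w p

end Paths

/-! ### The finite convex part of the Schreier graph of `H`. -/

section CosetGraph

variable {α : Type*}

theorem wordVal_of (w : Word α) : wordVal FreeGroup.of w = mk w := by
  rw [wordVal, lift_of_eq_id, MonoidHom.id_apply]

/-- The points of `F ⧸ H` on the paths from the base point that are labelled by the words in
`W`. -/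
noncomputable def pathPoints (H : Subgroup (FreeGroup α)) (W : List (Word α)) :
    Finset (FreeGroup α ⧸ H) :=
  open Classical in
  (((1 : FreeGroup α) : FreeGroup α ⧸ H) ::
    W.flatMap fun w => w.tails.map fun s => ((mk s : FreeGroup α) : FreeGroup α ⧸ H)).toFinset

/-- A bound for the number of points on the paths labelled by the words in `W`. -/
def pathBound (W : List (Word α)) : ℕ :=
  W.foldr (fun w s => w.length + 1 + s) 1

theorem card_pathPoints_le (H : Subgroup (FreeGroup α)) (W : List (Word α)) :
    (pathPoints H W).card ≤ pathBound W := by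
  classical
  refine (List.toFinset_card_le _).trans (le_of_eq ?_)
  induction W with
  | nil => rfl
  | cons w W ih =>
    simp only [List.flatMap_cons, List.length_cons, List.length_append, List.length_map,
      List.length_tails, pathBound, List.foldr_cons] at ih ⊢
    omega

theorem one_mem_pathPoints (H : Subgroup (FreeGroup α)) (W : List (Word α)) :
    ((1 : FreeGroup α) : FreeGroup α ⧸ H) ∈ pathPoints H W := by
  simp [pathPoints]

theorem mk_mem_pathPoints {H : Subgroup (FreeGroup α)} {W : List (Word α)} {w s : Word α}
    (hw : w ∈ W) (hs : s <:+ w) : ((mk s : FreeGroup α) : FreeGroup α ⧸ H) ∈ pathPoints H W := by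
  simp only [pathPoints, List.mem_toFinset, List.mem_cons, List.mem_flatMap, List.mem_map,
    List.mem_tails]
  exact Or.inr ⟨w, hw, s, hs, rfl⟩

theorem stays_pathPoints {H : Subgroup (FreeGroup α)} {W : List (Word α)} {w : Word α}
    (hw : w ∈ W) : Stays (pathPoints H W : Set (FreeGroup α ⧸ H)) w
      ((1 : FreeGroup α) : FreeGroup α ⧸ H) := by
  refine stays_of_suffix fun s hs => ?_
  have := mk_mem_pathPoints (H := H) hw hs
  rwa [MulAction.Quotient.smul_coe, smul_eq_mul, mul_one]

theorem exists_stays_of_mem_pathPoints {H : Subgroup (FreeGroup α)} {W : List (Word α)}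
    {p : FreeGroup α ⧸ H} (hp : p ∈ pathPoints H W) :
    ∃ s : Word α, Stays (pathPoints H W : Set (FreeGroup α ⧸ H)) s
      ((1 : FreeGroup α) : FreeGroup α ⧸ H) ∧ p = ((mk s : FreeGroup α) : FreeGroup α ⧸ H) := by
  simp only [pathPoints, List.mem_toFinset, List.mem_cons, List.mem_flatMap, List.mem_map,
    List.mem_tails] at hp
  rcases hp with rfl | ⟨w, hw, s, ⟨t, rfl⟩, rfl⟩
  · exact ⟨[], one_mem_pathPoints H W, rfl⟩
  · exact ⟨s, (stays_append.1 (stays_pathPoints hw)).1, rfl⟩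

/-- The generators label loops at the base point inside the set. Concatenating and reversing such
loops reaches all of `H`. -/
theorem exists_stays_of_mem {L W : List (Word α)} (hLW : ∀ w ∈ L, w ∈ W) {h : FreeGroup α}
    (hh : h ∈ wordSubgroup FreeGroup.of L) :
    ∃ s : Word α, mk s = h ∧
      Stays (pathPoints (wordSubgroup FreeGroup.of L) W :
        Set (FreeGroup α ⧸ wordSubgroup FreeGroup.of L)) s
        ((1 : FreeGroup α) : FreeGroup α ⧸ wordSubgroup FreeGroup.of L) := by
  have base : ∀ g ∈ wordSubgroup FreeGroup.of L,
      g • ((1 : FreeGroup α) : FreeGroup α ⧸ wordSubgroup FreeGroup.of L) =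
        ((1 : FreeGroup α) : FreeGroup α ⧸ wordSubgroup FreeGroup.of L) := by
    intro g hg
    rw [MulAction.Quotient.smul_coe, smul_eq_mul, mul_one, eq_comm, QuotientGroup.eq]
    simpa using hg
  change h ∈ Subgroup.closure _ at hh
  induction hh using Subgroup.closure_induction with
  | mem g hg =>
    obtain ⟨w, hw, rfl⟩ := hg
    exact ⟨w, (wordVal_of w).symm, stays_pathPoints (hLW w hw)⟩
  | one => exact ⟨[], rfl, one_mem_pathPoints _ W⟩
  | mul g g' hg hg' ih ih' =>
    obtain ⟨s, rfl, hs⟩ := ih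
    obtain ⟨s', rfl, hs'⟩ := ih'
    refine ⟨s ++ s', mul_mk.symm, stays_append.2 ⟨hs', ?_⟩⟩
    rw [base _ hg']
    exact hs
  | inv g hg ih =>
    obtain ⟨s, rfl, hs⟩ := ih
    refine ⟨FreeGroup.invRev s, inv_mk.symm, ?_⟩
    have := hs.invRev
    rwa [base _ hg] at this

/-- The two points are joined through the base point, with a loop from `H` inserted so that the path
represents the same element as `w`. Then `w` is the reduction of this path, and `Stays.red` applies.
-/
theorem isPathConvex_pathPoints {L W : List (Word α)} (hLW : ∀ w ∈ L, w ∈ W) :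
    IsPathConvex α (pathPoints (wordSubgroup FreeGroup.of L) W :
      Set (FreeGroup α ⧸ wordSubgroup FreeGroup.of L)) := by
  classical
  intro w p hw hp hq
  obtain ⟨s, hs, rfl⟩ := exists_stays_of_mem_pathPoints hp
  obtain ⟨t, ht, hqt⟩ := exists_stays_of_mem_pathPoints hq
  rw [MulAction.Quotient.smul_coe, smul_eq_mul, eq_comm, QuotientGroup.eq] at hqt
  obtain ⟨h, hh, hst⟩ := exists_stays_of_mem hLW hqt
  have one_smul_mk : ∀ v : Word α,
      mk v • ((1 : FreeGroup α) : FreeGroup α ⧸ wordSubgroup FreeGroup.of L) =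
        ((mk v : FreeGroup α) : FreeGroup α ⧸ wordSubgroup FreeGroup.of L) := fun v => by
    rw [MulAction.Quotient.smul_coe, smul_eq_mul, mul_one]
  have e1 : mk (FreeGroup.invRev s) • ((mk s : FreeGroup α) :
      FreeGroup α ⧸ wordSubgroup FreeGroup.of L) = ((1 : FreeGroup α) : _) := by
    rw [← inv_mk, MulAction.Quotient.smul_coe, smul_eq_mul, inv_mul_cancel]
  have e2 : mk h • ((1 : FreeGroup α) : FreeGroup α ⧸ wordSubgroup FreeGroup.of L) =
      ((1 : FreeGroup α) : _) := by
    rw [hh, MulAction.Quotient.smul_coe, smul_eq_mul, mul_one, eq_comm, QuotientGroup.eq]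
    simpa using hqt
  have key : Stays (pathPoints (wordSubgroup FreeGroup.of L) W :
      Set (FreeGroup α ⧸ wordSubgroup FreeGroup.of L)) (t ++ (h ++ FreeGroup.invRev s))
      ((mk s : FreeGroup α) : FreeGroup α ⧸ wordSubgroup FreeGroup.of L) := by
    rw [stays_append, stays_append, mk_append_smul, e1, e2]
    refine ⟨⟨?_, hst⟩, ht⟩
    have := hs.invRev
    rwa [one_smul_mk] at this
  have hred := key.red (reduce.red (L := t ++ (h ++ FreeGroup.invRev s)))
  have hmk : mk (t ++ (h ++ FreeGroup.invRev s)) = mk w := by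
    rw [← mul_mk, ← mul_mk, hh, ← inv_mk]
    group
  rwa [reduce.sound hmk, hw.reduce_eq] at hred

end CosetGraph

/-! ### Completion of a finite partial action to permutations. -/

section Completion

variable {α S : Type*} [MulAction (FreeGroup α) S]

/-- Marshall Hall completion: a finite part of a Schreier graph embeds into a permutation action on
`{0, …, N - 1}`. -/
theorem exists_perm_of_card_le (Γ : Finset S) {x₀ : S} (hx₀ : x₀ ∈ Γ) {N : ℕ} (hN : Γ.card ≤ N) :
    ∃ (σ : α → Equiv.Perm ℕ) (e : Γ → ℕ), Function.Injective e ∧ e ⟨x₀, hx₀⟩ = 0 ∧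
      (∀ i k, N ≤ k → σ i k = k) ∧
      ∀ (w : List (α × Bool)) (p q : Γ), Stays (Γ : Set S) w p → mk w • (p : S) = q →
        FreeGroup.lift σ (mk w) (e p) = e q := by
  classical
  -- A generator induces a partial injection of `Γ`, which extends to a permutation because `Γ` is
  -- finite.
  have h1 : ∀ i : α, ∃ τ : Equiv.Perm Γ, ∀ p : Γ, FreeGroup.of i • (p : S) ∈ Γ →
      ((τ p : Γ) : S) = FreeGroup.of i • (p : S) := by
    intro i
    obtain ⟨g, hg⟩ := Finset.exists_equiv_extend_of_card_eq (α := Γ) (t := Γ) (by simp)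
      (s := Finset.univ.filter fun p : Γ => FreeGroup.of i • (p : S) ∈ Γ)
      (f := fun p => FreeGroup.of i • (p : S))
      (by intro x hx; simp only [Finset.mem_image, Finset.mem_filter] at hx; grind)
      (fun p _ q _ h => Subtype.ext (smul_left_cancel _ h))
    exact ⟨g, fun p hp => hg p (by simpa using hp)⟩
  choose τ hτ using h1
  have hpos : 0 < Γ.card := Finset.card_pos.2 ⟨x₀, hx₀⟩
  obtain ⟨E, hE⟩ := Finset.exists_equiv_extend_of_card_eq (α := Γ) (t := Finset.range Γ.card)
      (by simp) (s := {⟨x₀, hx₀⟩}) (f := fun _ => 0) (by simpa using ⟨x₀, hx₀⟩) (by simp)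
  refine ⟨fun i => (τ i).extendDomain E, fun p => E p, ?_, hE _ (by simp), ?_, ?_⟩
  · intro p q h
    exact E.injective (Subtype.ext h)
  · intro i k hk
    apply Equiv.Perm.extendDomain_apply_not_subtype
    simp only [Finset.mem_range]
    omega
  · intro w
    induction w with
    | nil =>
      intro p q _ h
      rw [mk_nil_smul] at h
      rw [Subtype.ext h, ← one_eq_mk]
      simp
    | cons a w ih =>
      intro p q hs hq
      have hr := hs.1.end_mem
      have hw := ih p ⟨_, hr⟩ hs.1 rfl
      obtain ⟨i, b⟩ := a
      have hsplit : mk ((i, b) :: w) = mk [(i, b)] * mk w := by rw [mul_mk]; rfl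
      rw [hsplit, mul_smul] at hq
      rw [hsplit, _root_.map_mul, Equiv.Perm.mul_apply, hw]
      cases b with
      | true =>
        have h2 := hτ i ⟨_, hr⟩ (by change mk [(i, true)] • _ ∈ Γ; rw [hq]; exact q.2)
        have h3 : τ i ⟨_, hr⟩ = q := Subtype.ext (h2.trans hq)
        rw [FreeGroup.lift_mk]
        simp [Equiv.Perm.extendDomain_apply_image, h3]
      | false =>
        -- An inverse letter traverses an edge backwards, so the edge is examined at its source `q`,
        -- where `τ i` agrees with the action.
        have hq' : FreeGroup.of i • (q : S) = mk w • (p : S) := by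
          rw [← hq, ← mul_smul]
          have : FreeGroup.of i * mk [(i, false)] = 1 := mul_inv_cancel (FreeGroup.of i)
          rw [this, one_smul]
        have h2 := hτ i q (by rw [hq']; exact hr)
        have h3 : τ i q = ⟨_, hr⟩ := Subtype.ext (h2.trans hq')
        rw [FreeGroup.lift_mk]
        simp only [List.map_cons, List.map_nil, List.prod_singleton, cond_false]
        rw [Equiv.Perm.inv_eq_iff_eq, ← h3, Equiv.Perm.extendDomain_apply_image]

end Completion

end RelativeOrder

namespace RelativeOrder

open FreeGroup

/-! ### Cyclic reduction and powers. -/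

section CyclicForm

variable {α : Type*}

/-- Here `c` is the cyclic reduction of `g`, so its copies do not cancel against each other or
against `v`. The exponent `0` is excluded because `v v⁻¹` need not be reduced. -/
theorem exists_conj_form (g : FreeGroup α) :
    ∃ v c : List (α × Bool), g = mk (v ++ c ++ FreeGroup.invRev v) ∧
      ∀ k, 1 ≤ k → IsReduced (v ++ (List.replicate k c).flatten ++ FreeGroup.invRev v) := by
  classical
  have hg : IsReduced g.toWord := isReduced_toWord
  have hc := reduceCyclically.conj_conjugator_reduceCyclically g.toWord
  refine ⟨reduceCyclically.conjugator g.toWord, reduceCyclically g.toWord, ?_, fun k hk => ?_⟩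
  · rw [hc, mk_toWord]
  · exact IsReduced.append_flatten_replicate_append
      (reduceCyclically.isCyclicallyReduced hg) (by rw [hc]; exact hg) (by omega)

theorem mk_flatten_replicate (c : List (α × Bool)) (k : ℕ) :
    mk (List.replicate k c).flatten = mk c ^ k := by
  induction k with
  | zero => rfl
  | succ k ih => rw [List.replicate_succ, List.flatten_cons, ← mul_mk, ih, pow_succ']

theorem mk_conj_pow (v c : List (α × Bool)) (k : ℕ) :
    mk (v ++ c ++ FreeGroup.invRev v) ^ k =
      mk (v ++ (List.replicate k c).flatten ++ FreeGroup.invRev v) := by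
  rw [← mul_mk, ← mul_mk, ← inv_mk, conj_pow, ← mul_mk, ← mul_mk, inv_mk, mk_flatten_replicate]

end CyclicForm

/-! ### The bound on the orders. -/

section Orders

variable {α S : Type*} [MulAction (FreeGroup α) S]

theorem relOrder_congr {G G' : Type*} [Group G] [Group G'] {A : Set G} {A' : Set G'} {g : G}
    {g' : G'} (h : ∀ k, 1 ≤ k → (g ^ k ∈ A ↔ g' ^ k ∈ A')) : relOrder A g = relOrder A' g' := by
  unfold relOrder
  congr 1
  ext k
  exact and_congr_right (h k)

theorem pow_relOrder_mem {G : Type*} [Group G] {A : Set G} {g : G} (h : relOrder A g ≠ 0) :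
    g ^ relOrder A g ∈ A :=
  ((relOrder_eq_iff A g _ (Nat.one_le_iff_ne_zero.2 h)).1 rfl).1

/-- If a power of `g` takes `y` to `x`, then one with exponent at most `|Γ|` does, when `Γ` is a
finite convex set that contains `x` and `y`. -/
theorem relOrder_le_card (Γ : Finset S) (hΓ : IsPathConvex α (Γ : Set S)) {x y : S} (hx : x ∈ Γ)
    (hy : y ∈ Γ) {A : Set (FreeGroup α)} (hA : ∀ g, g ∈ A ↔ g • y = x) (g : FreeGroup α) :
    relOrder A g ≤ Γ.card := by
  by_contra! hlt
  set m := relOrder A g with hm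
  have hmem : g ^ m • y = x := (hA _).1 (pow_relOrder_mem (by omega))
  have hmin := ((relOrder_eq_iff A g m (by omega)).1 rfl).2
  obtain ⟨v, c, rfl, hred⟩ := exists_conj_form g
  have hst : Stays (Γ : Set S)
      (v ++ (List.replicate m c).flatten ++ FreeGroup.invRev v) y := by
    refine hΓ _ _ (hred m (by omega)) hy ?_
    rw [← mk_conj_pow, hmem]
    exact hx
  rw [List.append_assoc, stays_append, stays_append] at hst
  -- Starting at `1` still leaves `m > |Γ|` indices, and keeps the exponent `m - j + i` found below
  -- positive.
  have hin : ∀ i ∈ Finset.Icc 1 m, mk c ^ i • mk (FreeGroup.invRev v) • y ∈ Γ := by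
    intro i hi
    obtain ⟨hi1, hi2⟩ := Finset.mem_Icc.1 hi
    have h := hst.1.2
    obtain ⟨j, hj⟩ := Nat.exists_eq_add_of_le' hi2
    rw [hj, List.replicate_add, List.flatten_append, stays_append] at h
    have := h.1.end_mem
    rwa [mk_flatten_replicate] at this
  obtain ⟨i, hi, j, hj, hij, heq⟩ := Finset.exists_ne_map_eq_of_card_lt_of_maps_to
    (by simpa using hlt) hin
  wlog hlt' : i < j generalizing i j
  · exact this j hj i hi hij.symm heq.symm (by omega)
  obtain ⟨hi1, hi2⟩ := Finset.mem_Icc.1 hi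
  obtain ⟨hj1, hj2⟩ := Finset.mem_Icc.1 hj
  have hpow : ∀ k, mk (v ++ c ++ FreeGroup.invRev v) ^ k • y =
      mk v • mk c ^ k • mk (FreeGroup.invRev v) • y := fun k => by
    rw [mk_conj_pow, mk_append_smul, mk_append_smul, mk_flatten_replicate]
  have heq' : mk (v ++ c ++ FreeGroup.invRev v) ^ i • y =
      mk (v ++ c ++ FreeGroup.invRev v) ^ j • y := by
    rw [hpow, hpow]
    exact congrArg _ heq
  -- Since `g^i` and `g^j` agree at `y`, the stretch between them can be cut out of `g^m`.
  refine hmin (m - j + i) (by omega) (by omega) ((hA _).2 ?_)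
  rw [pow_add, mul_smul, heq', ← mul_smul, ← pow_add, Nat.sub_add_cancel hj2, hmem]

end Orders

/-! ### Signatures of words and short witnesses for the orders. -/

section Signature

variable {α S : Type*} [MulAction (FreeGroup α) S]

/-- The pairs of points of `Γ` joined by a path in `Γ` labelled by `w`. -/
def trace (Γ : Finset S) (w : List (α × Bool)) (p q : Γ) : Prop :=
  Stays (Γ : Set S) w p ∧ mk w • (p : S) = q

theorem trace_append (Γ : Finset S) (v w : List (α × Bool)) (p q : Γ) :
    trace Γ (v ++ w) p q ↔ ∃ r, trace Γ w p r ∧ trace Γ v r q := by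
  constructor
  · rintro ⟨h1, h2⟩
    rw [stays_append] at h1
    rw [mk_append_smul] at h2
    exact ⟨⟨_, h1.1.end_mem⟩, ⟨h1.1, rfl⟩, h1.2, h2⟩
  · rintro ⟨r, ⟨h1, h2⟩, h3, h4⟩
    refine ⟨stays_append.2 ⟨h1, ?_⟩, ?_⟩
    · rw [h2]; exact h3
    · rw [mk_append_smul, h2, h4]

theorem trace_invRev (Γ : Finset S) (w : List (α × Bool)) (p q : Γ) :
    trace Γ (FreeGroup.invRev w) p q ↔ trace Γ w q p := by
  have key : ∀ (w : List (α × Bool)) (p q : Γ), trace Γ w p q →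
      trace Γ (FreeGroup.invRev w) q p := by
    rintro w p q ⟨h1, h2⟩
    have h3 := h1.invRev
    rw [h2] at h3
    refine ⟨h3, ?_⟩
    rw [← inv_mk, inv_smul_eq_iff, h2]
  refine ⟨fun h => ?_, key w q p⟩
  simpa using key _ _ _ h

/-- The information about a word that determines how its occurrences in reduced words act
on `Γ`. -/
def signature (Γ : Finset S) (w : List (α × Bool)) :
    (Γ → Γ → Prop) × Option (α × Bool) × Option (α × Bool) × Prop :=
  (trace Γ w, w.head?, w.getLast?, IsReduced w)

/-- Traces compose as relations, and whether a concatenation of reduced words is reduced depends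
only on the two letters that meet. -/
theorem signature_append {Γ : Finset S} {v v' w w' : List (α × Bool)}
    (hv : signature Γ v = signature Γ v') (hw : signature Γ w = signature Γ w') :
    signature Γ (v ++ w) = signature Γ (v' ++ w') := by
  simp only [signature, Prod.mk.injEq] at hv hw ⊢
  obtain ⟨hv1, hv2, hv3, hv4⟩ := hv
  obtain ⟨hw1, hw2, hw3, hw4⟩ := hw
  refine ⟨?_, ?_, ?_, ?_⟩
  · funext p q
    rw [trace_append, trace_append, hv1, hw1]
  · rw [List.head?_append, List.head?_append, hv2, hw2]
  · rw [List.getLast?_append, List.getLast?_append, hv3, hw3]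
  · rw [FreeGroup.IsReduced, FreeGroup.IsReduced, List.isChain_append, List.isChain_append, hv3, hw2]
    rw [FreeGroup.IsReduced, FreeGroup.IsReduced] at hv4 hw4
    rw [hv4, hw4]

theorem isReduced_invRev {w : List (α × Bool)} :
    IsReduced (FreeGroup.invRev w) ↔ IsReduced w := by
  classical
  rw [isReduced_iff_reduce_eq, isReduced_iff_reduce_eq, reduce_invRev,
    FreeGroup.invRev_injective.eq_iff]

theorem signature_invRev {Γ : Finset S} {v v' : List (α × Bool)}
    (hv : signature Γ v = signature Γ v') :
    signature Γ (FreeGroup.invRev v) = signature Γ (FreeGroup.invRev v') := by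
  simp only [signature, Prod.mk.injEq] at hv ⊢
  obtain ⟨hv1, hv2, hv3, hv4⟩ := hv
  refine ⟨?_, ?_, ?_, ?_⟩
  · funext p q
    rw [trace_invRev, trace_invRev, hv1]
  · simp [FreeGroup.invRev, hv3]
  · simp [FreeGroup.invRev, hv2]
  · rw [isReduced_invRev, isReduced_invRev, hv4]

theorem signature_flatten_replicate {Γ : Finset S} {v v' : List (α × Bool)}
    (hv : signature Γ v = signature Γ v') (k : ℕ) :
    signature Γ (List.replicate k v).flatten = signature Γ (List.replicate k v').flatten := by
  induction k with
  | zero => rfl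
  | succ k ih =>
    rw [List.replicate_succ, List.replicate_succ, List.flatten_cons, List.flatten_cons]
    exact signature_append hv ih

/-- Every word has the signature of a word whose length is less than the number of signatures. -/
theorem exists_short_signature_eq [Finite α] (Γ : Finset S) (w : List (α × Bool)) :
    ∃ w' : List (α × Bool), signature Γ w' = signature Γ w ∧ w'.length <
      Nat.card ((Γ → Γ → Prop) × Option (α × Bool) × Option (α × Bool) × Prop) := by
  have := Fintype.ofFinite ((Γ → Γ → Prop) × Option (α × Bool) × Option (α × Bool) × Prop)
  rw [Nat.card_eq_fintype_card]
  induction hn : w.length using Nat.strong_induction_on generalizing w with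
  | _ n ih =>
    by_cases hlt : w.length <
        Fintype.card ((Γ → Γ → Prop) × Option (α × Bool) × Option (α × Bool) × Prop)
    · exact ⟨w, rfl, hlt⟩
    -- Two prefixes of a long word share a signature; removing the segment between them shortens the
    -- word and keeps its signature.
    · obtain ⟨i, hi, j, hj, hij, heq⟩ := Finset.exists_ne_map_eq_of_card_lt_of_maps_to
        (s := Finset.range (w.length + 1)) (t := Finset.univ)
        (f := fun i => signature Γ (w.take i))
        (by rw [Finset.card_univ, Finset.card_range]; omega) (fun _ _ => Finset.mem_univ _)
      wlog hlt' : i < j generalizing i j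
      · exact this j hj i hi hij.symm heq.symm (by omega)
      rw [Finset.mem_range] at hi hj
      have hs : signature Γ (w.take i ++ w.drop j) = signature Γ w := by
        conv_rhs => rw [← List.take_append_drop j w]
        exact signature_append heq rfl
      obtain ⟨w', h1, h2⟩ := ih (w.take i ++ w.drop j).length
        (by rw [List.length_append, List.length_take, List.length_drop]; omega) _ rfl
      exact ⟨w', h1.trans hs, h2⟩

/-- Every order is the order of an element of bounded length. -/
theorem exists_short_relOrder_eq [Finite α] (Γ : Finset S) (hΓ : IsPathConvex α (Γ : Set S))
    {x y : S} (hx : x ∈ Γ) (hy : y ∈ Γ) {A : Set (FreeGroup α)} (hA : ∀ g, g ∈ A ↔ g • y = x)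
    (g : FreeGroup α) :
    ∃ w : List (α × Bool), relOrder A (mk w) = relOrder A g ∧ w.length ≤
      3 * Nat.card ((Γ → Γ → Prop) × Option (α × Bool) × Option (α × Bool) × Prop) := by
  obtain ⟨v, c, rfl, hred⟩ := exists_conj_form g
  obtain ⟨v', hv, hvl⟩ := exists_short_signature_eq Γ v
  obtain ⟨c', hc, hcl⟩ := exists_short_signature_eq Γ c
  refine ⟨v' ++ c' ++ FreeGroup.invRev v', relOrder_congr fun k hk => ?_, ?_⟩
  · have hs : signature Γ (v' ++ (List.replicate k c').flatten ++ FreeGroup.invRev v') =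
        signature Γ (v ++ (List.replicate k c).flatten ++ FreeGroup.invRev v) :=
      signature_append (signature_append hv (signature_flatten_replicate hc k))
        (signature_invRev hv)
    simp only [signature, Prod.mk.injEq] at hs
    have htr : ∀ w : List (α × Bool), IsReduced w →
        (mk w • y = x ↔ trace Γ w ⟨y, hy⟩ ⟨x, hx⟩) := fun w hw =>
      ⟨fun h => ⟨hΓ w y hw hy (by rw [h]; exact hx), h⟩, fun h => h.2⟩
    -- Equality of signatures makes the new word reduced as well, so convexity lets the traces
    -- decide membership for both elements.
    rw [hA, hA, mk_conj_pow, mk_conj_pow, htr _ (hred k hk), htr _ (hs.2.2.2 ▸ hred k hk), hs.1]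
  · simp only [List.length_append, FreeGroup.invRev_length]
    omega

end Signature

/-! ### Application to right cosets of `H`. -/

section CosetOrders

variable {α : Type*}

theorem mem_rightCoset_iff (H : Subgroup (FreeGroup α)) (u g : FreeGroup α) :
    g ∈ rightCoset H u ↔ g * u⁻¹ ∈ H := by
  constructor
  · rintro ⟨h, hh, rfl⟩
    simpa using hh
  · intro h
    exact ⟨_, h, by simp⟩

theorem mem_rightCoset_iff_smul (H : Subgroup (FreeGroup α)) (u g : FreeGroup α) :
    g ∈ rightCoset H u ↔
      g • ((u⁻¹ : FreeGroup α) : FreeGroup α ⧸ H) = ((1 : FreeGroup α) : FreeGroup α ⧸ H) := by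
  rw [mem_rightCoset_iff, MulAction.Quotient.smul_coe, smul_eq_mul, eq_comm, QuotientGroup.eq]
  simp

theorem inv_mk_mem_pathPoints (H : Subgroup (FreeGroup α)) (L : List (Word α)) (u : Word α) :
    (((mk u)⁻¹ : FreeGroup α) : FreeGroup α ⧸ H) ∈
      pathPoints H (FreeGroup.invRev u :: L) := by
  rw [inv_mk]
  exact mk_mem_pathPoints List.mem_cons_self (List.suffix_refl _)

theorem relOrder_le_pathBound (L : List (Word α)) (u : Word α) (g : FreeGroup α) :
    relOrder (rightCoset (wordSubgroup FreeGroup.of L) (mk u)) g ≤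
      pathBound (FreeGroup.invRev u :: L) :=
  (relOrder_le_card _ (isPathConvex_pathPoints fun _ => List.mem_cons_of_mem _)
    (one_mem_pathPoints _ _) (inv_mk_mem_pathPoints _ L u)
    (fun g => mem_rightCoset_iff_smul _ _ g) g).trans (card_pathPoints_le _ _)

/-- A bound for the length of the elements that realize the orders. -/
def witnessBound (n : ℕ) (N : ℕ) : ℕ :=
  3 * (2 ^ (N * N) * ((n * 2 + 1) * ((n * 2 + 1) * 2)))

theorem exists_relOrder_eq_of_length_le {n : ℕ} (L : List (Word (Fin n))) (u : Word (Fin n))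
    (g : FreeGroup (Fin n)) :
    ∃ w : Word (Fin n),
      relOrder (rightCoset (wordSubgroup FreeGroup.of L) (mk u)) (mk w) =
        relOrder (rightCoset (wordSubgroup FreeGroup.of L) (mk u)) g ∧
      w.length ≤ witnessBound n (pathBound (FreeGroup.invRev u :: L)) := by
  obtain ⟨w, h1, h2⟩ := exists_short_relOrder_eq
    (pathPoints (wordSubgroup FreeGroup.of L) (FreeGroup.invRev u :: L))
    (isPathConvex_pathPoints fun _ => List.mem_cons_of_mem _)
    (one_mem_pathPoints _ _) (inv_mk_mem_pathPoints _ L u)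
    (fun g => mem_rightCoset_iff_smul _ _ g) g
  refine ⟨w, h1, h2.trans ?_⟩
  have hM := card_pathPoints_le (wordSubgroup FreeGroup.of L) (FreeGroup.invRev u :: L)
  -- There are `2 ^ (|Γ| * |Γ|)` relations on `Γ`, `2n + 1` values for each optional end letter and
  -- two truth values.
  simp only [Nat.card_prod, Nat.card_fun, Nat.card_eq_fintype_card, Fintype.card_option,
    Fintype.card_prod, Fintype.card_fin, Fintype.card_bool, Fintype.card_coe, Fintype.card_prop,
    witnessBound, ← pow_mul]
  gcongr
  norm_num

theorem exists_word_list {H : Subgroup (FreeGroup α)} (hH : H.FG) :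
    ∃ L : List (Word α), wordSubgroup FreeGroup.of L = H := by
  classical
  obtain ⟨T, rfl⟩ := hH
  refine ⟨T.toList.map toWord, ?_⟩
  rw [wordSubgroup]
  congr 1
  ext g
  simp [wordVal_of, mk_toWord]

theorem finite_ordSpectrum_rightCoset {H : Subgroup (FreeGroup α)} (hH : H.FG)
    (u : FreeGroup α) : (ordSpectrum (rightCoset H u)).Finite := by
  obtain ⟨L, rfl⟩ := exists_word_list hH
  obtain ⟨w, rfl⟩ := Quot.exists_rep u
  refine (Set.finite_Iic (pathBound (FreeGroup.invRev w :: L))).subset ?_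
  rintro _ ⟨g, rfl⟩
  exact relOrder_le_pathBound L w g

end CosetOrders

end RelativeOrder

namespace RelativeOrder

open FreeGroup

/-! ### Permutations coded by lists of transpositions. -/

section Swaps

/-- Multiplying on the left by the transposition of `N` and `σ N` makes the top point fixed, which
allows induction. -/
theorem exists_swap_list (N : ℕ) : ∀ σ : Equiv.Perm ℕ, (∀ k, N ≤ k → σ k = k) →
    ∃ l : List (ℕ × ℕ), l.length ≤ N ∧ (∀ e ∈ l, e.1 < N ∧ e.2 < N) ∧
      (l.map fun e => Equiv.swap e.1 e.2).prod = σ := by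
  induction N with
  | zero =>
    intro σ h
    exact ⟨[], le_rfl, by simp, Equiv.ext fun k => (h k k.zero_le).symm⟩
  | succ N ih =>
    intro σ h
    have hN : σ N ≤ N := by
      by_contra! hlt
      exact hlt.ne (σ.injective (h _ hlt)).symm
    obtain ⟨l, h1, h2, h3⟩ := ih (Equiv.swap N (σ N) * σ) fun k hk => by
      rcases hk.eq_or_lt with rfl | hk
      · simp
      · rw [Equiv.Perm.mul_apply, h k hk, Equiv.swap_apply_of_ne_of_ne (by omega) (by omega)]
    refine ⟨(N, σ N) :: l, by simpa using h1, ?_, ?_⟩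
    · intro e he
      rcases List.mem_cons.1 he with rfl | he
      · exact ⟨N.lt_succ_self, by simpa using Nat.lt_succ_of_le hN⟩
      · exact ⟨(h2 e he).1.trans N.lt_succ_self, (h2 e he).2.trans N.lt_succ_self⟩
    · rw [List.map_cons, List.prod_cons, h3, ← mul_assoc, Equiv.swap_mul_self, one_mul]

variable {α : Type*} [DecidableEq α]

/-- A list of labelled transpositions gives a permutation for each label. -/
def swapPerm (D : List (α × ℕ × ℕ)) (i : α) : Equiv.Perm ℕ :=
  (D.map fun e => if e.1 = i then Equiv.swap e.2.1 e.2.2 else (1 : Equiv.Perm ℕ)).prod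

/-- The action of a labelled transposition on a point, for the letter `i`. -/
def swapStep (i : α) (e : α × ℕ × ℕ) (p : ℕ) : ℕ :=
  if e.1 = i then if p = e.2.1 then e.2.2 else if p = e.2.2 then e.2.1 else p else p

/-- The action of a letter on a point. -/
def letterAct (D : List (α × ℕ × ℕ)) (a : α × Bool) (p : ℕ) : ℕ :=
  bif a.2 then D.foldr (fun e p => swapStep a.1 e p) p
  else D.foldl (fun p e => swapStep a.1 e p) p

/-- The action of a word on a point. -/
def wordAct (D : List (α × ℕ × ℕ)) (w : Word α) (p : ℕ) : ℕ :=
  w.foldr (letterAct D) p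

theorem swapStep_eq (i : α) (e : α × ℕ × ℕ) (p : ℕ) :
    swapStep i e p = (if e.1 = i then Equiv.swap e.2.1 e.2.2 else 1 : Equiv.Perm ℕ) p := by
  unfold swapStep
  split_ifs <;> simp_all [Equiv.swap_apply_def]

theorem foldr_swapStep (D : List (α × ℕ × ℕ)) (i : α) (p : ℕ) :
    D.foldr (fun e p => swapStep i e p) p = swapPerm D i p := by
  induction D with
  | nil => rfl
  | cons e D ih =>
    rw [List.foldr_cons, ih, swapStep_eq, swapPerm, swapPerm, List.map_cons, List.prod_cons,
      Equiv.Perm.mul_apply]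

/-- Transpositions are involutions, so applying them in the opposite order gives the inverse. -/
theorem foldl_swapStep (D : List (α × ℕ × ℕ)) (i : α) (p : ℕ) :
    D.foldl (fun p e => swapStep i e p) p = (swapPerm D i)⁻¹ p := by
  induction D generalizing p with
  | nil => rfl
  | cons e D ih =>
    rw [List.foldl_cons, ih, swapStep_eq, swapPerm, swapPerm, List.map_cons, List.prod_cons,
      mul_inv_rev, Equiv.Perm.mul_apply]
    congr 1
    split_ifs <;> simp

theorem wordAct_eq (D : List (α × ℕ × ℕ)) (w : Word α) (p : ℕ) :
    wordAct D w p = FreeGroup.lift (swapPerm D) (mk w) p := by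
  induction w with
  | nil => rfl
  | cons a w ih =>
    have hsplit : mk (a :: w) = mk [a] * mk w := by rw [mul_mk]; rfl
    change letterAct D a (wordAct D w p) = _
    rw [ih, hsplit, _root_.map_mul, Equiv.Perm.mul_apply, FreeGroup.lift_mk (L := [a]), letterAct,
      foldr_swapStep, foldl_swapStep]
    obtain ⟨i, _ | _⟩ := a <;> simp

end Swaps

/-! ### Deciding membership in `H`. -/

section Membership

/-- The lists over `A` of length at most `k`. -/
def listsUpTo {β : Type*} (A : List β) : ℕ → List (List β)
  | 0 => [[]]
  | k + 1 => [] :: A.flatMap fun a => (listsUpTo A k).map fun l => a :: l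

theorem mem_listsUpTo {β : Type*} {A : List β} {k : ℕ} {l : List β} :
    l ∈ listsUpTo A k ↔ l.length ≤ k ∧ ∀ a ∈ l, a ∈ A := by
  induction k generalizing l with
  | zero =>
    simp only [listsUpTo, List.mem_singleton, Nat.le_zero, List.length_eq_zero_iff]
    exact ⟨fun h => ⟨h, by simp [h]⟩, fun h => h.1⟩
  | succ k ih =>
    cases l with
    | nil => simp [listsUpTo]
    | cons b l =>
      simp only [listsUpTo, List.mem_cons, List.mem_flatMap, List.mem_map, ih]
      simp only [reduceCtorEq, List.cons.injEq, false_or, List.length_cons, Nat.add_le_add_iff_right,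
        forall_eq_or_imp]
      constructor
      · rintro ⟨a, ha, l', h, rfl, rfl⟩
        exact ⟨h.1, ha, h.2⟩
      · rintro ⟨h1, h2, h3⟩
        exact ⟨b, h2, l, ⟨h1, h3⟩, rfl, rfl⟩

variable {n : ℕ}

/-- The labelled transpositions of points below `N`. -/
def labelledSwaps (n N : ℕ) : List (Fin n × ℕ × ℕ) :=
  (List.finRange n).flatMap fun i => (List.range N).flatMap fun a => (List.range N).map fun b =>
    (i, a, b)

theorem mem_labelledSwaps {N : ℕ} {e : Fin n × ℕ × ℕ} :
    e ∈ labelledSwaps n N ↔ e.2.1 < N ∧ e.2.2 < N := by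
  obtain ⟨i, a, b⟩ := e
  simp [labelledSwaps]

/-- The transposition lists of the `n` permutations are labelled and concatenated; for the letter
`i`, the blocks with other labels act trivially. -/
theorem exists_swapPerm_eq {N : ℕ} (σ : Fin n → Equiv.Perm ℕ)
    (hσ : ∀ i k, N ≤ k → σ i k = k) :
    ∃ D ∈ listsUpTo (labelledSwaps n N) (n * N), swapPerm D = σ := by
  choose l h1 h2 h3 using fun i => exists_swap_list N (σ i) (hσ i)
  have hpart : ∀ (J : List (Fin n)) (i : Fin n), J.Nodup →
      swapPerm (J.flatMap fun j => (l j).map fun e => (j, e.1, e.2)) i =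
        if i ∈ J then σ i else 1 := by
    intro J i
    induction J with
    | nil => intro _; rfl
    | cons j J ih =>
      intro hJ
      rw [List.nodup_cons] at hJ
      have ih := ih hJ.2
      unfold swapPerm at ih ⊢
      rw [List.flatMap_cons, List.map_append, List.prod_append, ih, List.map_map]
      by_cases hij : j = i
      · subst hij
        have hc : (l j).map ((fun e : Fin n × ℕ × ℕ =>
            if e.1 = j then Equiv.swap e.2.1 e.2.2 else 1) ∘ fun e : ℕ × ℕ => (j, e.1, e.2)) =
            (l j).map fun e => Equiv.swap e.1 e.2 := by
          apply List.map_congr_left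
          intro e _
          simp
        rw [hc, h3, if_neg hJ.1, if_pos List.mem_cons_self, mul_one]
      · have hc : (l j).map ((fun e : Fin n × ℕ × ℕ =>
            if e.1 = i then Equiv.swap e.2.1 e.2.2 else 1) ∘ fun e : ℕ × ℕ => (j, e.1, e.2)) =
            (l j).map fun _ => 1 := by
          apply List.map_congr_left
          intro e _
          simp [hij]
        rw [hc, List.prod_eq_one (by simp), one_mul]
        simp [List.mem_cons, Ne.symm hij]
  refine ⟨(List.finRange n).flatMap fun j => (l j).map fun e => (j, e.1, e.2),
    mem_listsUpTo.2 ⟨?_, ?_⟩, ?_⟩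
  · rw [List.length_flatMap]
    refine (List.sum_le_card_nsmul _ N ?_).trans (by simp)
    intro k hk
    obtain ⟨j, _, rfl⟩ := List.mem_map.1 hk
    simpa using h1 j
  · intro e he
    obtain ⟨j, _, he⟩ := List.mem_flatMap.1 he
    obtain ⟨e', he', rfl⟩ := List.mem_map.1 he
    exact mem_labelledSwaps.2 (h2 j e' he')
  · funext i
    rw [hpart _ i (List.nodup_finRange n), if_pos (List.mem_finRange i)]

/-- The membership test: every permutation action of bounded degree in which the words in `L` fix
`0` has `w` fix `0`. -/
def MemTest (L : List (Word (Fin n))) (w : Word (Fin n)) : Prop :=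
  ∀ D ∈ listsUpTo (labelledSwaps n (pathBound (w :: L))) (n * pathBound (w :: L)),
    (∀ v ∈ L, wordAct D v 0 = 0) → wordAct D w 0 = 0

/-- If the test holds, it applies to the completion of the part of `F ⧸ H` spanned by `w` and `L`;
there the base point is `0` and points stay distinct, so `w` fixes the base point. Conversely, the
elements that fix `0` form a subgroup. -/
theorem memTest_iff (L : List (Word (Fin n))) (w : Word (Fin n)) :
    MemTest L w ↔ mk w ∈ wordSubgroup FreeGroup.of L := by
  constructor
  · intro h
    obtain ⟨σ, e, he, he0, hσ, hact⟩ := exists_perm_of_card_le (α := Fin n)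
      (pathPoints (wordSubgroup FreeGroup.of L) (w :: L)) (one_mem_pathPoints _ _)
      (card_pathPoints_le _ _)
    obtain ⟨D, hD, rfl⟩ := exists_swapPerm_eq σ hσ
    have hread : ∀ (v : Word (Fin n)) (hv : v ∈ w :: L), wordAct D v 0 =
        e ⟨((mk v : FreeGroup (Fin n)) : FreeGroup (Fin n) ⧸ wordSubgroup FreeGroup.of L),
          mk_mem_pathPoints hv (List.suffix_refl _)⟩ := by
      intro v hv
      rw [wordAct_eq, ← he0]
      refine hact v _ _ (stays_pathPoints hv) ?_
      rw [MulAction.Quotient.smul_coe, smul_eq_mul, mul_one]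
    have hfix : ∀ v ∈ L, wordAct D v 0 = 0 := by
      intro v hv
      rw [hread v (List.mem_cons_of_mem _ hv), ← he0]
      congr 2
      rw [eq_comm, QuotientGroup.eq, inv_one, one_mul]
      exact Subgroup.subset_closure ⟨v, hv, wordVal_of v⟩
    have h0 := h D hD hfix
    rw [hread w List.mem_cons_self, ← he0] at h0
    have := congrArg Subtype.val (he h0)
    rw [eq_comm, QuotientGroup.eq, inv_one, one_mul] at this
    exact this
  · intro h D _ hfix
    have hle : wordSubgroup FreeGroup.of L ≤
        (MulAction.stabilizer (Equiv.Perm ℕ) 0).comap (FreeGroup.lift (swapPerm D)) := by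
      refine (Subgroup.closure_le _).2 ?_
      rintro _ ⟨v, hv, rfl⟩
      rw [wordVal_of]
      have := hfix v hv
      rwa [wordAct_eq] at this
    have := hle h
    rw [wordAct_eq]
    exact this

end Membership

/-! ### Bounded searches for the order and the spectrum. -/

section Algorithms

variable {n : ℕ}

/-- The order of `w` in the coset `H u` is `k`, for some `k ≥ 1`, if `k` is the least one that
satisfies this condition. -/
def CosetTest (p : List (Word (Fin n)) × Word (Fin n) × Word (Fin n)) (k : ℕ) : Prop :=
  1 ≤ k ∧ MemTest p.1 ((List.replicate k p.2.2).flatten ++ FreeGroup.invRev p.2.1)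

theorem cosetTest_iff (L : List (Word (Fin n))) (u w : Word (Fin n)) (k : ℕ) :
    CosetTest (L, u, w) k ↔
      1 ≤ k ∧ mk w ^ k ∈ rightCoset (wordSubgroup FreeGroup.of L) (mk u) := by
  rw [CosetTest, memTest_iff, mem_rightCoset_iff, ← mul_mk, mk_flatten_replicate, inv_mk]

open Classical in
/-- The order of `w` in the coset `H u`. -/
noncomputable def cosetOrder (p : List (Word (Fin n)) × Word (Fin n) × Word (Fin n)) : ℕ :=
  -- A failed search returns the length of the list, one more than the bound, and is turned into the
  -- order `0`. The candidate `0` itself always fails `CosetTest`.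
  (fun k => if k ≤ pathBound (FreeGroup.invRev p.2.1 :: p.1) then k else 0)
    ((List.range (pathBound (FreeGroup.invRev p.2.1 :: p.1) + 1)).findIdx
      fun k => decide (CosetTest p k))

theorem cosetOrder_eq (L : List (Word (Fin n))) (u w : Word (Fin n)) :
    cosetOrder (L, u, w) =
      relOrder (rightCoset (wordSubgroup FreeGroup.of L) (mk u)) (mk w) := by
  classical
  set N := pathBound (FreeGroup.invRev u :: L) with hN
  set m := (List.range (N + 1)).findIdx fun k => decide (CosetTest (L, u, w) k) with hm
  have hval : cosetOrder (L, u, w) = if m ≤ N then m else 0 := rfl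
  have hlow : ∀ i, i < m → ¬ CosetTest (L, u, w) i := by
    intro i hi h
    have := List.not_of_lt_findIdx hi
    simp [h] at this
  rw [hval]
  split_ifs with hmN
  · have hlt : m < (List.range (N + 1)).length := by rw [List.length_range]; omega
    have h : CosetTest (L, u, w) m := by
      have := List.findIdx_getElem (w := hlt)
      simpa using this
    rw [cosetTest_iff] at h
    refine ((relOrder_eq_iff _ _ _ h.1).2 ⟨h.2, fun i hi him hmem => ?_⟩).symm
    exact hlow i him ((cosetTest_iff _ _ _ _).2 ⟨hi, hmem⟩)
  · symm
    by_contra hne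
    have hle := relOrder_le_pathBound L u (mk w)
    exact hlow _ (by omega)
      ((cosetTest_iff _ _ _ _).2 ⟨Nat.one_le_iff_ne_zero.2 hne, pow_relOrder_mem hne⟩)

/-- The letters and their inverses. -/
def letters (n : ℕ) : List (Fin n × Bool) :=
  (List.finRange n).flatMap fun i => [(i, true), (i, false)]

theorem mem_letters (a : Fin n × Bool) : a ∈ letters n := by
  obtain ⟨i, _ | _⟩ := a <;> simp [letters]

open Classical in
/-- The orders in the coset `H u`, in increasing order. -/
noncomputable def cosetSpectrum (p : List (Word (Fin n)) × Word (Fin n)) : List ℕ :=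
  (List.range (pathBound (FreeGroup.invRev p.2 :: p.1) + 1)).filter fun k =>
    ∃ w ∈ listsUpTo (letters n) (witnessBound n (pathBound (FreeGroup.invRev p.2 :: p.1))),
      cosetOrder (p.1, p.2, w) = k

theorem listsSet_cosetSpectrum (L : List (Word (Fin n))) (u : Word (Fin n)) :
    ListsSet (cosetSpectrum (L, u))
      (ordSpectrum (rightCoset (wordSubgroup FreeGroup.of L) (mk u))) := by
  refine ⟨List.Pairwise.filter _ List.pairwise_lt_range, fun k => ?_⟩
  simp only [cosetSpectrum, List.mem_filter, List.mem_range, decide_eq_true_eq]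
  constructor
  · rintro ⟨_, w, _, rfl⟩
    exact ⟨mk w, (cosetOrder_eq L u w).symm⟩
  · rintro ⟨g, rfl⟩
    obtain ⟨w, h1, h2⟩ := exists_relOrder_eq_of_length_le L u g
    refine ⟨Nat.lt_succ_of_le (relOrder_le_pathBound L u g), w,
      mem_listsUpTo.2 ⟨h2, fun a _ => mem_letters a⟩, ?_⟩
    rw [cosetOrder_eq, h1]

end Algorithms

/-! ### The searches are primitive recursive. -/

section Primrec

open Primrec

variable {β : Type*} [Primcodable β] {n : ℕ}

theorem primrec_listsUpTo : Primrec₂ (listsUpTo : List β → ℕ → List (List β)) := by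
  have h : Primrec₂ fun (A : List β) (k : ℕ) => (Nat.rec [[]] (fun _ r =>
      [] :: A.flatMap fun a => r.map fun l => a :: l) k : List (List β)) := by
    have h1 : Primrec₂ fun (q : List β × ℕ × List (List β)) (a : β) =>
        q.2.2.map fun l => a :: l :=
      list_map (snd.comp (snd.comp fst)) (list_cons.comp (snd.comp fst) snd).to₂
    have h2 : Primrec₂ fun (A : List β) (q : ℕ × List (List β)) =>
        [] :: A.flatMap fun a => q.2.map fun l => a :: l :=
      (list_cons.comp (const _) (list_flatMap fst h1)).to₂
    exact nat_rec (const _) h2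
  refine h.of_eq fun A k => ?_
  induction k with
  | zero => rfl
  | succ k ih => simp only [listsUpTo, ← ih]

theorem primrec_labelledSwaps : Primrec (labelledSwaps n) := by
  refine list_flatMap (const _) ?_
  refine list_flatMap (list_range.comp fst) ?_
  refine list_map (list_range.comp (fst.comp fst)) ?_
  exact Primrec.pair (snd.comp (fst.comp fst)) (Primrec.pair (snd.comp fst) snd)

theorem primrec_pathBound : Primrec (pathBound : List (Word (Fin n)) → ℕ) := by
  have h : Primrec₂ fun (_ : List (Word (Fin n))) (q : Word (Fin n) × ℕ) =>
      q.1.length + 1 + q.2 :=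
    (nat_add.comp (succ.comp (list_length.comp (fst.comp snd))) (snd.comp snd)).to₂
  exact list_foldr Primrec.id (const 1) h

theorem primrec_invRev : Primrec (FreeGroup.invRev : Word (Fin n) → Word (Fin n)) := by
  refine list_reverse.comp (list_map Primrec.id ?_)
  exact Primrec.pair (fst.comp snd) (Primrec.not.comp (snd.comp snd))

theorem primrec_flatten_replicate :
    Primrec₂ fun (w : List β) (k : ℕ) => (List.replicate k w).flatten := by
  have h : Primrec₂ fun (w : List β) (k : ℕ) => (Nat.rec [] (fun _ r => w ++ r) k : List β) :=
    nat_rec (const _) (list_append.comp fst (snd.comp snd)).to₂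
  refine h.of_eq fun w k => ?_
  induction k with
  | zero => rfl
  | succ k ih => rw [List.replicate_succ, List.flatten_cons, ← ih]

theorem primrec_two_pow : Primrec fun k : ℕ => 2 ^ k := by
  have h : Primrec fun k : ℕ => (Nat.rec 1 (fun _ r => 2 * r) k : ℕ) :=
    nat_rec₁ 1 (nat_mul.comp (const 2) snd).to₂
  refine h.of_eq fun k => ?_
  induction k with
  | zero => rfl
  | succ k ih => rw [pow_succ', ← ih]

theorem primrec_witnessBound : Primrec (witnessBound n) :=
  nat_mul.comp (const _) (nat_mul.comp (primrec_two_pow.comp (nat_mul.comp .id .id)) (const _))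

theorem primrec_swapStep :
    Primrec fun q : Fin n × (Fin n × ℕ × ℕ) × ℕ => swapStep q.1 q.2.1 q.2.2 := by
  have hi : Primrec fun q : Fin n × (Fin n × ℕ × ℕ) × ℕ => q.1 := fst
  have hj : Primrec fun q : Fin n × (Fin n × ℕ × ℕ) × ℕ => q.2.1.1 := fst.comp (fst.comp snd)
  have ha : Primrec fun q : Fin n × (Fin n × ℕ × ℕ) × ℕ => q.2.1.2.1 :=
    fst.comp (snd.comp (fst.comp snd))
  have hb : Primrec fun q : Fin n × (Fin n × ℕ × ℕ) × ℕ => q.2.1.2.2 :=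
    snd.comp (snd.comp (fst.comp snd))
  have hp : Primrec fun q : Fin n × (Fin n × ℕ × ℕ) × ℕ => q.2.2 := snd.comp snd
  exact Primrec.ite (Primrec.eq.comp hj hi)
    (Primrec.ite (Primrec.eq.comp hp ha) hb (Primrec.ite (Primrec.eq.comp hp hb) ha hp)) hp

theorem primrec_letterAct :
    Primrec fun q : List (Fin n × ℕ × ℕ) × (Fin n × Bool) × ℕ => letterAct q.1 q.2.1 q.2.2 := by
  have h1 : Primrec₂ fun (q : List (Fin n × ℕ × ℕ) × (Fin n × Bool) × ℕ)
      (r : (Fin n × ℕ × ℕ) × ℕ) => swapStep q.2.1.1 r.1 r.2 :=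
    (primrec_swapStep.comp (Primrec.pair (fst.comp (fst.comp (snd.comp fst))) snd)).to₂
  have h2 : Primrec₂ fun (q : List (Fin n × ℕ × ℕ) × (Fin n × Bool) × ℕ)
      (r : ℕ × (Fin n × ℕ × ℕ)) => swapStep q.2.1.1 r.2 r.1 :=
    (primrec_swapStep.comp (Primrec.pair (fst.comp (fst.comp (snd.comp fst)))
      (Primrec.pair (snd.comp snd) (fst.comp snd)))).to₂
  exact Primrec.cond (snd.comp (fst.comp snd)) (list_foldr fst (snd.comp snd) h1)
    (list_foldl fst (snd.comp snd) h2)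

theorem primrec_wordAct_zero :
    Primrec₂ fun (D : List (Fin n × ℕ × ℕ)) (w : Word (Fin n)) => wordAct D w 0 := by
  have h : Primrec₂ fun (q : List (Fin n × ℕ × ℕ) × Word (Fin n)) (r : (Fin n × Bool) × ℕ) =>
      letterAct q.1 r.1 r.2 :=
    (primrec_letterAct.comp (Primrec.pair (fst.comp fst) snd)).to₂
  exact list_foldr snd (const 0) h

theorem primrecRel_memTest : PrimrecRel (MemTest (n := n)) := by
  have hfix : PrimrecRel fun (w : Word (Fin n)) (D : List (Fin n × ℕ × ℕ)) => wordAct D w 0 = 0 :=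
    Primrec.eq.comp (primrec_wordAct_zero.comp snd fst) (const 0)
  have himp : PrimrecRel fun (D : List (Fin n × ℕ × ℕ)) (p : List (Word (Fin n)) × Word (Fin n)) =>
      (∀ v ∈ p.1, wordAct D v 0 = 0) → wordAct D p.2 0 = 0 := by
    have h1 := (hfix.forall_mem_list.comp (fst.comp snd) fst :
      PrimrecPred fun q : List (Fin n × ℕ × ℕ) × List (Word (Fin n)) × Word (Fin n) =>
        ∀ v ∈ q.2.1, wordAct q.1 v 0 = 0)
    have h2 := (hfix.comp (snd.comp snd) fst :
      PrimrecPred fun q : List (Fin n × ℕ × ℕ) × List (Word (Fin n)) × Word (Fin n) =>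
        wordAct q.1 q.2.2 0 = 0)
    exact (h1.not.or h2).of_eq fun q => imp_iff_not_or.symm
  have hN : Primrec fun p : List (Word (Fin n)) × Word (Fin n) => pathBound (p.2 :: p.1) :=
    primrec_pathBound.comp (list_cons.comp snd fst)
  exact himp.forall_mem_list.comp
    (primrec_listsUpTo.comp (primrec_labelledSwaps.comp hN) (nat_mul.comp (const n) hN)) .id

theorem primrecRel_cosetTest : PrimrecRel (CosetTest (n := n)) := by
  refine PrimrecPred.and (nat_le.comp (const 1) snd) (primrecRel_memTest.comp (fst.comp fst) ?_)
  exact list_append.comp (primrec_flatten_replicate.comp (snd.comp (snd.comp fst)) snd)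
    (primrec_invRev.comp (fst.comp (snd.comp fst)))

theorem primrec_cosetOrder : Primrec (cosetOrder (n := n)) := by
  classical
  have hN : Primrec fun p : List (Word (Fin n)) × Word (Fin n) × Word (Fin n) =>
      pathBound (FreeGroup.invRev p.2.1 :: p.1) :=
    primrec_pathBound.comp (list_cons.comp (primrec_invRev.comp (fst.comp snd)) fst)
  have hm : Primrec fun p : List (Word (Fin n)) × Word (Fin n) × Word (Fin n) =>
      (List.range (pathBound (FreeGroup.invRev p.2.1 :: p.1) + 1)).findIdx
        fun k => decide (CosetTest p k) :=
    list_findIdx (list_range.comp (succ.comp hN)) primrecRel_cosetTest.decide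
  exact Primrec.ite (nat_le.comp hm hN) hm (const 0)

theorem primrec_cosetSpectrum : Primrec (cosetSpectrum (n := n)) := by
  classical
  have hN : Primrec fun p : List (Word (Fin n)) × Word (Fin n) =>
      pathBound (FreeGroup.invRev p.2 :: p.1) :=
    primrec_pathBound.comp (list_cons.comp (primrec_invRev.comp snd) fst)
  have h1 : PrimrecRel fun (w : Word (Fin n)) (q : ℕ × List (Word (Fin n)) × Word (Fin n)) =>
      cosetOrder (q.2.1, q.2.2, w) = q.1 :=
    Primrec.eq.comp (primrec_cosetOrder.comp (Primrec.pair (fst.comp (snd.comp snd))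
      (Primrec.pair (snd.comp (snd.comp snd)) fst))) (fst.comp snd)
  have h2 : PrimrecRel fun (k : ℕ) (p : List (Word (Fin n)) × Word (Fin n)) =>
      ∃ w ∈ listsUpTo (letters n) (witnessBound n (pathBound (FreeGroup.invRev p.2 :: p.1))),
        cosetOrder (p.1, p.2, w) = k :=
    h1.exists_mem_list.comp (primrec_listsUpTo.comp (const _)
      (primrec_witnessBound.comp (hN.comp snd))) .id
  exact h2.listFilter.comp (list_range.comp (succ.comp hN)) .id

theorem primrecRel_mem_list_nat : PrimrecRel fun (l : List ℕ) (k : ℕ) => k ∈ l := by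
  have h : PrimrecRel fun (a b : ℕ) => a = b := Primrec.eq
  exact h.exists_mem_list.of_eq fun l k => by simp

end Primrec

/-! ### Periodicity and purity in terms of the spectrum. -/

section Periodicity

theorem rightCoset_one {G : Type*} [Group G] (H : Subgroup G) : rightCoset H 1 = (H : Set G) := by
  simp [rightCoset]

theorem relOrder_eq_one_iff {G : Type*} [Group G] (A : Set G) (g : G) :
    relOrder A g = 1 ↔ g ∈ A := by
  rw [relOrder_eq_iff A g 1 le_rfl, pow_one]
  exact and_iff_left fun i hi hi' => absurd hi' (by omega)

theorem isPeriodicGroup_iff {G : Type*} [Group G] (H : Subgroup G) :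
    IsPeriodicGroup H ↔ 0 ∉ ordSpectrum (H : Set G) := by
  simp only [IsPeriodicGroup, IsPeriodicElt, ordSpectrum, Set.mem_range, not_exists,
    Nat.one_le_iff_ne_zero, ne_eq]

/-- Order `1` means membership in `H`, so purity says exactly that no order is `2` or more. -/
theorem isPure_iff {G : Type*} [Group G] (H : Subgroup G) :
    IsPure H ↔ ∀ k ∈ ordSpectrum (H : Set G), k < 2 := by
  rw [IsPure, Set.ext_iff, ordSpectrum, Set.forall_mem_range]
  refine forall_congr' fun g => ?_
  rw [← relOrder_eq_one_iff (H : Set G)]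
  change (1 ≤ relOrder (H : Set G) g ↔ _) ↔ _
  omega

end Periodicity

end RelativeOrder

namespace RelativeOrder

/-! ### The decision problems, with `H` treated as the coset of the empty word. -/

section Main

variable {n : ℕ}

theorem cosetOrder_nil_eq (L : List (Word (Fin n))) (w : Word (Fin n)) :
    cosetOrder (L, [], w) =
      relOrder (wordSubgroup FreeGroup.of L : Set (FreeGroup (Fin n)))
        (wordVal FreeGroup.of w) := by
  rw [cosetOrder_eq, ← FreeGroup.one_eq_mk, rightCoset_one, wordVal_of]

theorem listsSet_cosetSpectrum_nil (L : List (Word (Fin n))) :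
    ListsSet (cosetSpectrum (L, []))
      (ordSpectrum (wordSubgroup FreeGroup.of L : Set (FreeGroup (Fin n)))) := by
  have := listsSet_cosetSpectrum L []
  rwa [← FreeGroup.one_eq_mk, rightCoset_one] at this

theorem computablePred_of_primrecPred {β : Type*} [Primcodable β] {p : β → Prop}
    (h : PrimrecPred p) : ComputablePred p := by
  obtain ⟨hd, h⟩ := h
  exact ⟨hd, h.to_comp⟩

theorem primrec_cosetSpectrum_nil :
    Primrec fun L : List (Word (Fin n)) => cosetSpectrum (L, []) :=
  primrec_cosetSpectrum.comp (Primrec.pair Primrec.id (Primrec.const []))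

theorem primrec_cosetOrder_nil :
    Primrec fun p : List (Word (Fin n)) × Word (Fin n) => cosetOrder (p.1, [], p.2) :=
  primrec_cosetOrder.comp
    (Primrec.pair Primrec.fst (Primrec.pair (Primrec.const []) Primrec.snd))

theorem cosetOrderComputable_freeGroup :
    CosetOrderComputable (FreeGroup.of : Fin n → FreeGroup (Fin n)) :=
  ⟨cosetOrder, primrec_cosetOrder.to_comp, fun L u w => by
    rw [wordVal_of, wordVal_of, cosetOrder_eq]⟩

theorem cosetSpectrumComputable_freeGroup :
    CosetSpectrumComputable (FreeGroup.of : Fin n → FreeGroup (Fin n)) :=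
  ⟨cosetSpectrum, primrec_cosetSpectrum.to_comp, fun L u => by
    rw [wordVal_of]
    exact listsSet_cosetSpectrum L u⟩

theorem orderProblem_freeGroup : OrderProblem (FreeGroup.of : Fin n → FreeGroup (Fin n)) :=
  ⟨_, primrec_cosetOrder_nil.to_comp, cosetOrder_nil_eq⟩

theorem torsionProblem_freeGroup : TorsionProblem (FreeGroup.of : Fin n → FreeGroup (Fin n)) :=
  computablePred_of_primrecPred <|
    (Primrec.nat_le.comp (Primrec.const 1) primrec_cosetOrder_nil).of_eq fun p => by
      rw [cosetOrder_nil_eq, IsPeriodicElt]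

theorem finiteSpectrumProblem_freeGroup :
    FiniteSpectrumProblem (FreeGroup.of : Fin n → FreeGroup (Fin n)) := by
  refine ⟨_, (Primrec.option_some.comp primrec_cosetSpectrum_nil).to_comp, fun L =>
    ⟨fun _ => ⟨_, rfl, listsSet_cosetSpectrum_nil L⟩, fun h => absurd ?_ h⟩⟩
  -- The spectrum is always finite, so the answer `none` never occurs.
  exact (cosetSpectrum (L, [])).finite_toSet.subset fun k hk =>
    ((listsSet_cosetSpectrum_nil L).2 k).2 hk

theorem spectrumMembershipProblem_freeGroup :
    SpectrumMembershipProblem (FreeGroup.of : Fin n → FreeGroup (Fin n)) :=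
  computablePred_of_primrecPred <|
    (primrecRel_mem_list_nat.comp (primrec_cosetSpectrum_nil.comp Primrec.fst)
      Primrec.snd).of_eq fun p => (listsSet_cosetSpectrum_nil p.1).2 p.2

theorem torsionGroupProblem_freeGroup :
    TorsionGroupProblem (FreeGroup.of : Fin n → FreeGroup (Fin n)) :=
  computablePred_of_primrecPred <|
    (primrecRel_mem_list_nat.comp primrec_cosetSpectrum_nil (Primrec.const 0)).not.of_eq
      fun L => by rw [isPeriodicGroup_iff, (listsSet_cosetSpectrum_nil L).2 0]

theorem purityProblem_freeGroup : PurityProblem (FreeGroup.of : Fin n → FreeGroup (Fin n)) := by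
  have h : PrimrecPred fun k : ℕ => k < 2 := Primrec.nat_lt.comp Primrec.id (Primrec.const 2)
  refine computablePred_of_primrecPred <|
    (h.forall_mem_list.comp primrec_cosetSpectrum_nil).of_eq fun L => ?_
  rw [isPure_iff]
  exact forall_congr' fun k => by rw [(listsSet_cosetSpectrum_nil L).2 k]

end Main

end RelativeOrder

theorem mainTheorem8 (n : ℕ) :
    RelativeOrder.CosetOrderComputable (FreeGroup.of : Fin n → FreeGroup (Fin n)) ∧
    (∀ H : Subgroup (FreeGroup (Fin n)), H.FG → ∀ u : FreeGroup (Fin n),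
      (RelativeOrder.ordSpectrum (RelativeOrder.rightCoset H u)).Finite) ∧
    RelativeOrder.CosetSpectrumComputable (FreeGroup.of : Fin n → FreeGroup (Fin n)) ∧
    RelativeOrder.OrderProblem (FreeGroup.of : Fin n → FreeGroup (Fin n)) ∧
    RelativeOrder.TorsionProblem (FreeGroup.of : Fin n → FreeGroup (Fin n)) ∧
    RelativeOrder.FiniteSpectrumProblem (FreeGroup.of : Fin n → FreeGroup (Fin n)) ∧
    RelativeOrder.SpectrumMembershipProblem (FreeGroup.of : Fin n → FreeGroup (Fin n)) ∧
    RelativeOrder.TorsionGroupProblem (FreeGroup.of : Fin n → FreeGroup (Fin n)) ∧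
    RelativeOrder.PurityProblem (FreeGroup.of : Fin n → FreeGroup (Fin n)) := by
  exact ⟨RelativeOrder.cosetOrderComputable_freeGroup,
    fun _ hH u => RelativeOrder.finite_ordSpectrum_rightCoset hH u,
    RelativeOrder.cosetSpectrumComputable_freeGroup, RelativeOrder.orderProblem_freeGroup,
    RelativeOrder.torsionProblem_freeGroup, RelativeOrder.finiteSpectrumProblem_freeGroup,
    RelativeOrder.spectrumMembershipProblem_freeGroup,
    RelativeOrder.torsionGroupProblem_freeGroup, RelativeOrder.purityProblem_freeGroup⟩
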